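/- Let $n \ge 1$, $q = 3^n$, $b \in \mathbb{F}_q^\times$, and let $E_{n,b}$ be the curve $$E_{n,b}:\quad y^2 = x^3 + b x + t^{3^n+1}$$ over $K = \mathbb{F}_{q^2}(t)$. Call an elliptic curve $E$ over $k(t)$ ($k$ a field) isotrivial if over some finite extension of $k(t)$ it becomes isomorphic to an elliptic curve defined over $k$, and call $E$ a cubic twist of $E'$ over a field $M$ if $E$ and $E'$ are not isomorphic over $M$ but become isomorphic over some separable extension of $M$ of degree $3$. Then: 1. $E_{n,b}$ is an elliptic curve over $K$, and it is isotrivial. More precisely, it is a cubic twist over $K$ of the constant curve $y^2 = x^3 + b x$. 2. If $n$ is odd or $b$ is a square in $\mathbb{F}_q$, then $E_{n,b}$ is a cubic twist over $K$ of the constant curve $y^2 = x^3 + x$. In all cases, over $\mathbb{F}_{q^4}(t)$ the curve $E_{n,b}$ is a cubic twist of $y^2 = x^3 + x$. 3. The Mordell–Weil group $E_{n,b}(K)$ is torsion-free. -/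

import Mathlib

open scoped WeierstrassCurve

universe u v

/-- The Weierstrass curve `y² = x³ + a x + c`. -/
def shortCurve {R : Type u} [CommRing R] (a c : R) : WeierstrassCurve R :=
  ⟨0, 0, 0, a, c⟩

/-- The curve `E_{n,b} : y² = x³ + b x + t^(3^n + 1)` over the rational function field `k(t)`,
where `b` lies in a subfield `F` of `k`. -/
noncomputable def curveE {F : Type u} [Field F] (k : Type v) [Field k] [Algebra F k]
    (n : ℕ) (b : F) : WeierstrassCurve (RatFunc k) :=
  shortCurve (RatFunc.C (algebraMap F k b)) (RatFunc.X ^ (3 ^ n + 1))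

/-- The constant curve over `k(t)` obtained from a curve over `k`. -/
noncomputable def constantCurve {k : Type u} [Field k] (E₀ : WeierstrassCurve k) :
    WeierstrassCurve (RatFunc k) :=
  E₀.map RatFunc.C

/-- Two Weierstrass curves over a field `K` are isomorphic over `K` (as curves with a marked
point at infinity): they are related by an admissible change of variables over `K`. -/
def CurvesIsomorphic {K : Type u} [Field K] (E E' : WeierstrassCurve K) : Prop :=
  ∃ c : WeierstrassCurve.VariableChange K, c • E = E'

/-- `E / k(t)` is isotrivial (potentially constant): over some finite extension of `k(t)` it becomes
isomorphic to (the base change of) an elliptic curve defined over `k`. -/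
def IsIsotrivial {k : Type u} [Field k] (E : WeierstrassCurve (RatFunc k)) : Prop :=
  ∃ (L : Type u) (_ : Field L) (_ : Algebra (RatFunc k) L) (E₀ : WeierstrassCurve k),
    FiniteDimensional (RatFunc k) L ∧ E₀.IsElliptic ∧
      CurvesIsomorphic (E.baseChange L) ((constantCurve E₀).baseChange L)

/-- `E` is a (nontrivial) cubic twist of `E'` over `K`: the two curves are not isomorphic over `K`,
but they become isomorphic over some separable extension of `K` of degree `3`. -/
def IsCubicTwist {K : Type u} [Field K] (E E' : WeierstrassCurve K) : Prop :=
  ¬ CurvesIsomorphic E E' ∧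
    ∃ (L : Type u) (_ : Field L) (_ : Algebra K L),
      Algebra.IsSeparable K L ∧ Module.finrank K L = 3 ∧
        CurvesIsomorphic (E.baseChange L) (E'.baseChange L)

/-! In characteristic 3, an isomorphism from y² = x³ + bx + t^m to a constant curve with zero
constant term yields a root in r of r³ + br + t^m. There is none in k(t): r would be a polynomial,
and a degree count gives 3 ∣ m, whereas m = 3^n + 1. The cubic has derivative b ≠ 0, so it defines a
separable cubic extension over which the curve becomes constant. Reaching y² = x³ + x only requires
b to be a fourth power, a divisibility question in a cyclic group. Torsion meets the same
obstruction. Tripling sends y to -b⁻⁶y⁹, so the finite orbit of a torsion point makes some power of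
y, hence y itself, constant; then x³ + bx + t^m = y² would be constant. -/

open Polynomial in
/-- A nonconstant power of the variable of degree prime to `3` is not a constant minus `r³ + b r`. -/
theorem Polynomial.cube_add_mul_add_X_pow_ne_C {k : Type u} [Field k] {m : ℕ} (hm : ¬ 3 ∣ m)
    (b d : k) (r : k[X]) : r ^ 3 + C b * r + X ^ m ≠ C d := by
  intro h
  have hX : (X ^ m : k[X]) = C d - (r ^ 3 + C b * r) := by rw [← h]; ring
  have hdeg : (C d - (r ^ 3 + C b * r)).natDegree = m := by rw [← hX, natDegree_X_pow]
  rcases Nat.eq_zero_or_pos r.natDegree with h0 | h0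
  · rw [eq_C_of_natDegree_eq_zero h0, ← C_pow, ← C_mul, ← C_add, ← C_sub, natDegree_C] at hdeg
    exact hm (hdeg ▸ dvd_zero 3)
  · have h3 : (r ^ 3).natDegree = 3 * r.natDegree := natDegree_pow r 3
    have h1 : (C b * r).natDegree ≤ r.natDegree := natDegree_C_mul_le b r
    rw [natDegree_sub_eq_right_of_natDegree_lt, natDegree_add_eq_left_of_natDegree_lt, h3] at hdeg
    · exact hm (hdeg ▸ dvd_mul_right 3 _)
    · omega
    · rw [natDegree_C, natDegree_add_eq_left_of_natDegree_lt] <;> omega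

-- The equation is monic in `r` over k[X], which is integrally closed, so `r` is a polynomial.
open Polynomial in
theorem ratFunc_cube_add_mul_add_X_pow_ne_C {k : Type u} [Field k] {m : ℕ} (hm : ¬ 3 ∣ m)
    (b d : k) (r : RatFunc k) : r ^ 3 + RatFunc.C b * r + RatFunc.X ^ m ≠ RatFunc.C d := by
  intro h
  have hint : IsIntegral k[X] r := by
    refine ⟨X ^ 3 + (C (C b) * X + C (X ^ m - C d)), monic_X_pow_add ?_, ?_⟩
    · exact lt_of_le_of_lt degree_linear_le (by norm_num)
    · have hc : algebraMap k[X] (RatFunc k) (X ^ m - C d) = RatFunc.X ^ m - RatFunc.C d := by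
        rw [map_sub, map_pow, RatFunc.algebraMap_X, RatFunc.algebraMap_C]
      simp only [eval₂_add, eval₂_mul, eval₂_pow, eval₂_X, eval₂_C, hc, RatFunc.algebraMap_C]
      linear_combination h
  obtain ⟨p, rfl⟩ := IsIntegrallyClosed.algebraMap_eq_of_integral hint
  refine Polynomial.cube_add_mul_add_X_pow_ne_C hm b d p
    (RatFunc.algebraMap_injective k ?_)
  simpa only [map_add, map_mul, map_pow, RatFunc.algebraMap_X, RatFunc.algebraMap_C] using h

open Polynomial in
/-- The field of constants is radically closed in the field of rational functions. -/
theorem ratFunc_exists_eq_C_of_pow_eq_C {k : Type u} [Field k] {N : ℕ} (hN : N ≠ 0)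
    {y : RatFunc k} {w : k} (h : y ^ N = RatFunc.C w) : ∃ d, y = RatFunc.C d := by
  have hint : IsIntegral k[X] y := by
    refine IsIntegral.of_pow (Nat.pos_of_ne_zero hN) ?_
    rw [h, ← RatFunc.algebraMap_C]
    exact isIntegral_algebraMap
  obtain ⟨p, rfl⟩ := IsIntegrallyClosed.algebraMap_eq_of_integral hint
  have hp : p ^ N = C w :=
    RatFunc.algebraMap_injective k (by rw [map_pow, h, RatFunc.algebraMap_C])
  have hdeg : p.natDegree = 0 := by
    have := congrArg natDegree hp
    rw [natDegree_pow, natDegree_C] at this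
    exact (Nat.mul_eq_zero.mp this).resolve_left hN
  exact ⟨p.coeff 0, by rw [← RatFunc.algebraMap_C, ← eq_C_of_natDegree_eq_zero hdeg]⟩

/-! ### Isomorphisms of short Weierstrass curves -/

/-- An isomorphism of short Weierstrass curves in characteristic `3` solves a cubic equation. -/
theorem CurvesIsomorphic.exists_cube {K : Type u} [Field K] (h3 : (3 : K) = 0) {a c a' c' : K}
    (h : CurvesIsomorphic (shortCurve a c) (shortCurve a' c')) :
    ∃ u r : K, r ^ 3 + a * r + c = u ^ 6 * c' := by
  obtain ⟨v, hv⟩ := h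
  have h2 : (2 : K) ≠ 0 := fun h2 ↦ one_ne_zero (by linear_combination h3 - h2 : (1 : K) = 0)
  have e1 := congrArg WeierstrassCurve.a₁ hv
  have e3 := congrArg WeierstrassCurve.a₃ hv
  have e6 := congrArg WeierstrassCurve.a₆ hv
  simp [WeierstrassCurve.variableChange_a₁, shortCurve, h2] at e1
  -- This gives 2t = 0, hence t = 0, which reduces the a₆ equation to the cubic in r.
  simp [WeierstrassCurve.variableChange_a₃, shortCurve, h2] at e3
  simp [WeierstrassCurve.variableChange_a₆, shortCurve, e3] at e6
  refine ⟨v.u, v.r, ?_⟩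
  have hu : (v.u : K) ≠ 0 := v.u.ne_zero
  rw [← e6]
  field_simp
  ring

theorem curvesIsomorphic_shortCurve {K : Type u} [Field K] (h3 : (3 : K) = 0) {a c a' c' u r : K}
    (hu : u ≠ 0) (ha : a = u ^ 4 * a') (hc : r ^ 3 + a * r + c = u ^ 6 * c') :
    CurvesIsomorphic (shortCurve a c) (shortCurve a' c') := by
  refine ⟨⟨Units.mk0 u hu, r, 0, 0⟩, ?_⟩
  ext
  · simp [WeierstrassCurve.variableChange_a₁, shortCurve]
  · simp [WeierstrassCurve.variableChange_a₂, shortCurve, h3]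
  · simp [WeierstrassCurve.variableChange_a₃, shortCurve]
  · simp [WeierstrassCurve.variableChange_a₄, shortCurve, h3, ha, hu]
  · simp only [WeierstrassCurve.variableChange_a₆, shortCurve, Units.val_inv_eq_inv_val,
      Units.val_mk0]
    field_simp
    linear_combination hc

theorem shortCurve_baseChange {K : Type u} [Field K] (L : Type v) [Field L] [Algebra K L]
    (a c : K) :
    (shortCurve a c).baseChange L = shortCurve (algebraMap K L a) (algebraMap K L c) := by
  ext <;> simp [shortCurve, WeierstrassCurve.baseChange]

theorem constantCurve_shortCurve {k : Type u} [Field k] (a c : k) :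
    constantCurve (shortCurve a c) = shortCurve (RatFunc.C a) (RatFunc.C c) := by
  ext <;> simp [shortCurve, constantCurve]

theorem shortCurve_isElliptic {K : Type u} [Field K] (h3 : (3 : K) = 0) {a : K} (ha : a ≠ 0)
    (c : K) : (shortCurve a c).IsElliptic := by
  refine ⟨?_⟩
  have : (shortCurve a c).Δ = -a ^ 3 := by
    simp only [WeierstrassCurve.Δ, WeierstrassCurve.b₂, WeierstrassCurve.b₄, WeierstrassCurve.b₆,
      WeierstrassCurve.b₈, shortCurve]
    linear_combination (-21 * a ^ 3 - 144 * c ^ 2) * h3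
  rw [this]
  exact (neg_ne_zero.mpr (pow_ne_zero 3 ha)).isUnit

/-! ### The trivializing cubic extension -/

open Polynomial in
/-- In characteristic `3`, a root of `X³ + a X + c` generates a separable cubic extension, unless
there already is a root. -/
theorem exists_separable_cubic_root {K : Type u} [Field K] (h3 : (3 : K) = 0) {a c : K}
    (ha : a ≠ 0) (hroot : ∀ r : K, r ^ 3 + a * r + c ≠ 0) :
    ∃ (L : Type u) (_ : Field L) (_ : Algebra K L),
      Algebra.IsSeparable K L ∧ Module.finrank K L = 3 ∧
        ∃ r : L, r ^ 3 + algebraMap K L a * r + algebraMap K L c = 0 := by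
  let p : K[X] := X ^ 3 + (C a * X + C c)
  have hlt : (C a * X + C c : K[X]).degree < (3 : ℕ) :=
    lt_of_le_of_lt degree_linear_le (by norm_num)
  have hmonic : p.Monic := monic_X_pow_add hlt
  have hdeg : p.natDegree = 3 := by
    rw [natDegree_add_eq_left_of_degree_lt (by rwa [degree_X_pow]), natDegree_X_pow]
  have hirr : Irreducible p := by
    refine irreducible_of_degree_le_three_of_not_isRoot (by simp [hdeg]) fun r hr ↦ hroot r ?_
    simpa [p, IsRoot, add_assoc] using hr
  have hsep : p.Separable := by
    have hder : derivative p = C a := by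
      simp only [p, derivative_add, derivative_X_pow, derivative_C_mul, derivative_X, derivative_C,
        Nat.cast_ofNat, h3, C_0, zero_mul, zero_add, mul_one, add_zero]
    rw [separable_def, hder]
    exact (isCoprime_one_right (x := p)).of_isCoprime_of_dvd_right
      (isUnit_C.mpr ha.isUnit).dvd
  have : Fact (Irreducible p) := ⟨hirr⟩
  refine ⟨AdjoinRoot p, inferInstance, inferInstance, ?_, ?_, AdjoinRoot.root p, ?_⟩
  · have hroot : IsSeparable K (AdjoinRoot.root p) := by
      rw [IsSeparable, AdjoinRoot.minpoly_root hirr.ne_zero, hmonic, inv_one, C_1, mul_one]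
      exact hsep
    rw [← AlgEquiv.Algebra.isSeparable_iff IntermediateField.topEquiv,
      ← IntermediateField.adjoin_root_eq_top p]
    exact (IntermediateField.isSeparable_adjoin_simple_iff_isSeparable K _).mpr hroot
  · rw [(AdjoinRoot.powerBasis hirr.ne_zero).finrank, AdjoinRoot.powerBasis_dim, hdeg]
  · have := AdjoinRoot.eval₂_root p
    simpa [p, add_assoc] using this

theorem ratFunc_three_eq_zero {k : Type u} [Field k] (h3 : (3 : k) = 0) : (3 : RatFunc k) = 0 := by
  rw [← map_ofNat (RatFunc.C : k →+* RatFunc k) 3, h3, map_zero]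

theorem three_eq_zero_of_card {k : Type u} [Field k] {m : ℕ} (hk : Nat.card k = 3 ^ m) :
    (3 : k) = 0 := by
  have : Finite k := Nat.finite_of_card_ne_zero (by rw [hk]; positivity)
  have := Fintype.ofFinite k
  have h : ((Nat.card k : ℕ) : k) = 0 := by rw [Nat.card_eq_fintype_card, FiniteField.cast_card_eq_zero]
  rw [hk, Nat.cast_pow] at h
  exact_mod_cast (pow_eq_zero_iff (by rintro rfl; simp at h)).mp h

theorem not_three_dvd_three_pow_add_one {n : ℕ} (hn : 1 ≤ n) : ¬ 3 ∣ 3 ^ n + 1 := by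
  have : 3 ∣ 3 ^ n := dvd_pow_self 3 (by omega)
  omega

/-- The scaling `u` serves both targets: `u = 1` for y² = x³ + bx, and `u ^ 4 = b` for y² = x³ + x.
-/
theorem exists_trivializing_cubic {F : Type u} [Field F] {k : Type v} [Field k] [Algebra F k]
    (h3 : (3 : k) = 0) {n : ℕ} (hn : 1 ≤ n) {b : F} {u a : k} (hu : u ≠ 0) (ha : a ≠ 0)
    (hb : algebraMap F k b = u ^ 4 * a) :
    ∃ (L : Type v) (_ : Field L) (_ : Algebra (RatFunc k) L),
      Algebra.IsSeparable (RatFunc k) L ∧ Module.finrank (RatFunc k) L = 3 ∧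
        CurvesIsomorphic ((curveE k n b).baseChange L)
          ((constantCurve (shortCurve a 0)).baseChange L) := by
  have hb0 : algebraMap F k b ≠ 0 := by rw [hb]; exact mul_ne_zero (pow_ne_zero 4 hu) ha
  obtain ⟨L, _, _, hsep, hfin, r, hr⟩ := exists_separable_cubic_root (ratFunc_three_eq_zero h3)
    (a := RatFunc.C (algebraMap F k b)) (c := RatFunc.X ^ (3 ^ n + 1))
    ((map_ne_zero _).mpr hb0) fun r hr ↦ ratFunc_cube_add_mul_add_X_pow_ne_C
      (not_three_dvd_three_pow_add_one hn) (algebraMap F k b) 0 r (by rw [hr, map_zero])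
  refine ⟨L, inferInstance, inferInstance, hsep, hfin, ?_⟩
  rw [constantCurve_shortCurve, curveE, shortCurve_baseChange, shortCurve_baseChange]
  refine curvesIsomorphic_shortCurve (u := algebraMap (RatFunc k) L (RatFunc.C u)) (r := r)
    ?_ ?_ ?_ ?_
  · rw [← map_ofNat (algebraMap (RatFunc k) L) 3, ratFunc_three_eq_zero h3, map_zero]
  · simpa using hu
  · rw [hb]; simp
  · rw [hr]; simp

theorem curveE_isCubicTwist {F : Type u} [Field F] {k : Type v} [Field k] [Algebra F k]
    (h3 : (3 : k) = 0) {n : ℕ} (hn : 1 ≤ n) {b : F} {u a : k} (hu : u ≠ 0) (ha : a ≠ 0)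
    (hb : algebraMap F k b = u ^ 4 * a) :
    IsCubicTwist (curveE k n b) (constantCurve (shortCurve a 0)) := by
  refine ⟨fun h ↦ ?_, exists_trivializing_cubic h3 hn hu ha hb⟩
  rw [constantCurve_shortCurve, curveE] at h
  obtain ⟨v, r, hr⟩ := h.exists_cube (ratFunc_three_eq_zero h3)
  exact ratFunc_cube_add_mul_add_X_pow_ne_C (not_three_dvd_three_pow_add_one hn)
    (algebraMap F k b) 0 r (by rw [hr]; simp)

theorem curveE_isIsotrivial {F : Type u} [Field F] {k : Type v} [Field k] [Algebra F k]
    (h3 : (3 : k) = 0) {n : ℕ} (hn : 1 ≤ n) {b : F} (hb : b ≠ 0) :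
    IsIsotrivial (curveE k n b) := by
  have hb0 : algebraMap F k b ≠ 0 := (map_ne_zero _).mpr hb
  obtain ⟨L, _, _, -, hfin, hiso⟩ := exists_trivializing_cubic h3 hn (one_ne_zero (α := k)) hb0
    (b := b) (by simp)
  exact ⟨L, inferInstance, inferInstance, shortCurve (algebraMap F k b) 0,
    Module.finite_of_finrank_pos (by omega), shortCurve_isElliptic h3 hb0 0, hiso⟩

/-! ### Powers in finite fields -/

/-- In an extension `k` of finite fields, the elements of the subfield `F` are `m`-th powers when
`m` divides the index of the unit groups. -/
theorem exists_pow_eq_algebraMap_of_card {F : Type u} [Field F] {k : Type v} [Field k] [Algebra F k]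
    [Finite F] [Finite k] {m : ℕ} (hcard : m * (Nat.card F - 1) ∣ Nat.card k - 1) {b : F}
    (hb : b ≠ 0) : ∃ u : k, u ≠ 0 ∧ algebraMap F k b = u ^ m := by
  obtain ⟨g, hg⟩ := IsCyclic.exists_generator (α := kˣ)
  have hord : orderOf g = Nat.card k - 1 := by
    rw [orderOf_eq_card_of_forall_mem_zpowers hg, Nat.card_units]
  let x : kˣ := Units.map (algebraMap F k).toMonoidHom (Units.mk0 b hb)
  obtain ⟨j, hj : g ^ j = x⟩ := hg x
  have hx : x ^ (Nat.card F - 1) = 1 := by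
    rw [← map_pow, ← Nat.card_units, pow_card_eq_one', map_one]
  have hF : Nat.card F - 1 ≠ 0 := Nat.sub_ne_zero_of_lt Finite.one_lt_card
  rw [← hj, ← zpow_natCast, ← zpow_mul, ← orderOf_dvd_iff_zpow_eq_one, hord] at hx
  -- The image of `b` is g^j with |k| - 1 dividing j(|F| - 1); cancelling |F| - 1 leaves m ∣ j.
  have hdvd : ((m * (Nat.card F - 1) : ℕ) : ℤ) ∣ j * ((Nat.card F - 1 : ℕ) : ℤ) :=
    (Int.natCast_dvd_natCast.mpr hcard).trans hx
  rw [Nat.cast_mul] at hdvd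
  obtain ⟨i, rfl⟩ := Int.dvd_of_mul_dvd_mul_right (by exact_mod_cast hF) hdvd
  refine ⟨(g ^ i : kˣ), Units.ne_zero _, ?_⟩
  have : x = (g ^ i) ^ m := by rw [← hj, mul_comm, zpow_mul, zpow_natCast]
  exact congrArg Units.val this

/-! ### Tripling and torsion -/

open WeierstrassCurve.Affine in
/-- In characteristic `3`, multiplication by `3` on `y² = x³ + a x + c` is purely inseparable:
up to constants it is the ninth power map in the ordinate. -/
theorem three_nsmul_shortCurve {K : Type u} [Field K] [DecidableEq K] (h3 : (3 : K) = 0) {a c : K}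
    (ha : a ≠ 0) {x y : K} (h : (shortCurve a c).toAffine.Nonsingular x y) :
    ∃ (x' : K) (h' : (shortCurve a c).toAffine.Nonsingular x' (-(a⁻¹ ^ 6 * y ^ 9))),
      3 • Point.some x y h = Point.some x' _ h' := by
  have h2 : (2 : K) ≠ 0 := fun h2 ↦ one_ne_zero (by linear_combination h3 - h2 : (1 : K) = 0)
  have hneg : ∀ x y, (shortCurve a c).toAffine.negY x y = -y := fun x y ↦ by
    simp [negY, shortCurve]
  rw [show (3 : ℕ) = 2 + 1 from rfl, succ_nsmul, two_nsmul]
  by_cases hy : y = 0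
  -- Here the point has order 2, so its triple is itself.
  · subst hy
    rw [Point.add_self_of_Y_eq (by rw [hneg, neg_zero]), zero_add]
    refine ⟨x, by simpa using h, ?_⟩
    simp
  · have hyn : y ≠ (shortCurve a c).toAffine.negY x y := by
      rw [hneg]
      intro e
      exact hy ((mul_eq_zero.mp (by linear_combination e : 2 * y = 0)).resolve_left h2)
    have hsl : (shortCurve a c).toAffine.slope x x y y = -a / y := by
      rw [slope_of_Y_ne rfl hyn, hneg]
      simp only [shortCurve]
      have : y - -y ≠ 0 := by
        rw [sub_neg_eq_add, ← two_mul]; exact mul_ne_zero h2 hy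
      rw [div_eq_div_iff this hy]
      linear_combination (x ^ 2 * y + a * y) * h3
    have hX : (shortCurve a c).toAffine.addX x x (-a / y) = x + (a / y) ^ 2 := by
      simp only [addX, shortCurve]
      linear_combination (-x) * h3
    have hY : (shortCurve a c).toAffine.addY x x y (-a / y) = -y + (a / y) ^ 3 := by
      simp only [addY, negAddY, hneg, hX]
      ring
    have hne : (shortCurve a c).toAffine.addX x x ((shortCurve a c).toAffine.slope x x y y) ≠ x := by
      rw [hsl, hX]
      simpa using ⟨ha, hy⟩
    rw [Point.add_self_of_Y_ne hyn, Point.add_of_X_ne hne]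
    have hsl' : (shortCurve a c).toAffine.slope
        ((shortCurve a c).toAffine.addX x x ((shortCurve a c).toAffine.slope x x y y)) x
        ((shortCurve a c).toAffine.addY x x y ((shortCurve a c).toAffine.slope x x y y)) y =
        y ^ 3 / a ^ 2 + a / y := by
      rw [slope_of_X_ne hne, hsl, hX, hY]
      field_simp
      linear_combination (-a ^ 2 * y ^ 4) * h3
    have hY' : (shortCurve a c).toAffine.addY
        ((shortCurve a c).toAffine.addX x x ((shortCurve a c).toAffine.slope x x y y)) x
        ((shortCurve a c).toAffine.addY x x y ((shortCurve a c).toAffine.slope x x y y))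
        ((shortCurve a c).toAffine.slope
          ((shortCurve a c).toAffine.addX x x ((shortCurve a c).toAffine.slope x x y y)) x
          ((shortCurve a c).toAffine.addY x x y ((shortCurve a c).toAffine.slope x x y y)) y) =
        -(a⁻¹ ^ 6 * y ^ 9) := by
      rw [hsl', hsl, hX, hY]
      simp only [addY, negAddY, addX, negY, shortCurve]
      -- The two sides differ by an explicit multiple of 3.
      have (e : K) (he : e = -(a⁻¹ ^ 6 * y ^ 9) +
          3 * (x * (y ^ 3 / a ^ 2 + a / y) - (y ^ 3 / a ^ 2) ^ 2 * (a / y))) :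
          e = -(a⁻¹ ^ 6 * y ^ 9) := by rw [he, h3, zero_mul, add_zero]
      apply this
      field_simp
      ring
    simp only [Point.some.injEq]
    refine ⟨_, ?_, rfl, hY'⟩
    rw [← hY']
    exact nonsingular_add (nonsingular_add h h fun e ↦ hyn e.2) h fun e ↦ hne e.1

open WeierstrassCurve.Affine in
theorem three_pow_nsmul_shortCurve {K : Type u} [Field K] [DecidableEq K] (h3 : (3 : K) = 0)
    (k : Subfield K) {a c : K} (ha : a ≠ 0) (hak : a ∈ k) {x y : K}
    (h : (shortCurve a c).toAffine.Nonsingular x y) (i : ℕ) :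
    ∃ w ∈ k, w ≠ 0 ∧ ∃ (x' : K) (h' : (shortCurve a c).toAffine.Nonsingular x' (w * y ^ 9 ^ i)),
      3 ^ i • Point.some x y h = Point.some x' _ h' := by
  induction i with
  | zero => exact ⟨1, k.one_mem, one_ne_zero, x, by simpa using h, by simp⟩
  | succ i ih =>
    obtain ⟨w, hwk, hw, x', h', e⟩ := ih
    obtain ⟨x'', h'', e''⟩ := three_nsmul_shortCurve h3 ha h'
    have key : -(a⁻¹ ^ 6 * (w * y ^ 9 ^ i) ^ 9) = -(a⁻¹ ^ 6 * w ^ 9) * y ^ 9 ^ (i + 1) := by ring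
    refine ⟨-(a⁻¹ ^ 6 * w ^ 9),
      k.neg_mem (k.mul_mem (k.pow_mem (k.inv_mem hak) 6) (k.pow_mem hwk 9)),
      neg_ne_zero.mpr (by positivity), x'', by rwa [key] at h'', ?_⟩
    rw [pow_succ', mul_nsmul', e, e'']
    simp only [key]

open WeierstrassCurve.Affine in
/-- The ordinate of a torsion point of `y² = x³ + a x + c` in characteristic `3` has a power lying
in any given subfield that contains `a`. -/
theorem exists_pow_mem_of_nsmul_eq_zero {K : Type u} [Field K] [DecidableEq K] (h3 : (3 : K) = 0)
    (k : Subfield K) {a c : K} (ha : a ≠ 0) (hak : a ∈ k) {x y : K}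
    (h : (shortCurve a c).toAffine.Nonsingular x y) {n : ℕ} (hn : n ≠ 0)
    (hP : n • Point.some x y h = 0) : ∃ N ≠ 0, y ^ N ∈ k := by
  have : NeZero n := ⟨hn⟩
  -- Since 3 may divide `n`, powers of 3 need not return to 1 modulo `n`; a repetition suffices.
  obtain ⟨i, j, hne, hij⟩ : ∃ i j, i ≠ j ∧ 3 ^ i % n = 3 ^ j % n := by
    by_contra! H
    refine not_injective_infinite_finite (fun i : ℕ ↦ Fin.ofNat n (3 ^ i)) fun i j e ↦ ?_
    by_contra hne
    exact H i j hne (congrArg Fin.val e)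
  wlog hlt : i < j generalizing i j
  · exact this j i hne.symm hij.symm (by omega)
  have hmod : ∀ m, (m % n) • Point.some x y h = m • Point.some x y h := fun m ↦ by
    conv_rhs => rw [← Nat.mod_add_div m n, add_nsmul, mul_comm, mul_nsmul', hP, nsmul_zero, add_zero]
  have heq : 3 ^ i • Point.some x y h = 3 ^ j • Point.some x y h := by
    rw [← hmod, hij, hmod]
  obtain ⟨w, hwk, hw, x₁, h₁, e₁⟩ := three_pow_nsmul_shortCurve h3 k ha hak h i
  obtain ⟨v, hvk, hv, x₂, h₂, e₂⟩ := three_pow_nsmul_shortCurve h3 k ha hak h j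
  rw [e₁, e₂] at heq
  have hy := (Point.some.inj heq).2
  by_cases hy0 : y = 0
  · exact ⟨1, one_ne_zero, by simp [hy0]⟩
  have hpow : 9 ^ i < 9 ^ j := Nat.pow_lt_pow_right (by norm_num) hlt
  refine ⟨9 ^ j - 9 ^ i, by omega, ?_⟩
  have : y ^ (9 ^ j - 9 ^ i) = w / v := by
    rw [eq_div_iff hv]
    refine mul_right_cancel₀ (pow_ne_zero (9 ^ i) hy0) ?_
    rw [hy, mul_right_comm, ← pow_add, Nat.sub_add_cancel hpow.le, mul_comm]
  rw [this]
  exact k.div_mem hwk hvk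

open WeierstrassCurve.Affine in
theorem curveE_isAddTorsionFree {F : Type u} [Field F] {k : Type v} [Field k] [Algebra F k]
    [DecidableEq (RatFunc k)] (h3 : (3 : k) = 0) {n : ℕ} (hn : 1 ≤ n) {b : F} (hb : b ≠ 0) :
    IsAddTorsionFree (curveE k n b).toAffine.Point := by
  have key : ∀ (m : ℕ), m ≠ 0 → ∀ P : (curveE k n b).toAffine.Point, m • P = 0 → P = 0 := by
    rintro m hm (_ | ⟨x, y, h⟩) hP
    · rfl
    · exfalso
      have hb0 : RatFunc.C (algebraMap F k b) ≠ 0 :=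
        (map_ne_zero _).mpr ((map_ne_zero _).mpr hb)
      obtain ⟨N, hN, w, hw⟩ := exists_pow_mem_of_nsmul_eq_zero (ratFunc_three_eq_zero h3)
        (RatFunc.C : k →+* RatFunc k).fieldRange hb0 ⟨_, rfl⟩ h hm hP
      obtain ⟨d, rfl⟩ := ratFunc_exists_eq_C_of_pow_eq_C hN hw.symm
      have heq := (equation_iff ..).mp h.1
      simp only [curveE, shortCurve] at heq
      refine ratFunc_cube_add_mul_add_X_pow_ne_C (not_three_dvd_three_pow_add_one hn)
        (algebraMap F k b) (d ^ 2) x ?_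
      rw [map_pow]
      linear_combination -heq
  refine ⟨fun m hm P Q e ↦ sub_eq_zero.mp (key m hm _ ?_)⟩
  rw [nsmul_sub, sub_eq_zero]
  exact e

theorem mainTheorem7 (n : ℕ) (hn : 1 ≤ n)
    -- `F` is the field with `q = 3 ^ n` elements, `k` the field with `q ^ 2` elements
    (F : Type u) [Field F] (hF : Nat.card F = 3 ^ n)
    (k : Type v) [Field k] [Algebra F k] (hk : Nat.card k = 3 ^ (2 * n))
    [DecidableEq (RatFunc k)]
    (b : F) (hb : b ≠ 0) :
    -- `E_{n,b}` over `K = k(t)` is an elliptic curve, and it is isotrivial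
    (curveE k n b).IsElliptic ∧
    IsIsotrivial (curveE k n b) ∧
    -- it is a cubic twist of the constant curve `y² = x³ + b x`
    IsCubicTwist (curveE k n b) (constantCurve (shortCurve (algebraMap F k b) 0)) ∧
    -- if `n` is odd or `b` is a square, it is a cubic twist over `K` of `y² = x³ + x`
    (Odd n ∨ IsSquare b →
      IsCubicTwist (curveE k n b) (constantCurve (shortCurve (1 : k) 0))) ∧
    -- in all cases it is a cubic twist of `y² = x³ + x` over `l(t)`, `l` with `q ^ 4` elements
    (∀ (l : Type v) [Field l] [Algebra F l], Nat.card l = 3 ^ (4 * n) →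
      IsCubicTwist (curveE l n b) (constantCurve (shortCurve (1 : l) 0))) ∧
    -- the Mordell–Weil group `E_{n,b}(K)` is torsion-free
    IsAddTorsionFree (curveE k n b).toAffine.Point := by
  have h3 : (3 : k) = 0 := three_eq_zero_of_card hk
  have hb0 : algebraMap F k b ≠ 0 := (map_ne_zero _).mpr hb
  have : Finite F := Nat.finite_of_card_ne_zero (by rw [hF]; positivity)
  have : Finite k := Nat.finite_of_card_ne_zero (by rw [hk]; positivity)
  refine ⟨shortCurve_isElliptic (ratFunc_three_eq_zero h3) ((map_ne_zero _).mpr hb0) _,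
    curveE_isIsotrivial h3 hn hb,
    curveE_isCubicTwist h3 hn one_ne_zero hb0 (by simp), fun hcase ↦ ?_, fun l _ _ hl ↦ ?_,
    curveE_isAddTorsionFree h3 hn hb⟩
  · have hfac : 3 ^ (2 * n) - 1 = (3 ^ n + 1) * (3 ^ n - 1) := by
      rw [← Nat.sq_sub_sq, one_pow, ← pow_mul, mul_comm]
    obtain ⟨u, hu, hbu⟩ : ∃ u : k, u ≠ 0 ∧ algebraMap F k b = u ^ 4 := by
      rcases hcase with ⟨m, rfl⟩ | ⟨s, rfl⟩
      · refine exists_pow_eq_algebraMap_of_card ?_ hb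
        rw [hF, hk, hfac]
        refine mul_dvd_mul_right ?_ _
        -- For odd n, q + 1 ≡ 4 modulo 8, so 4 divides the index q + 1 of the unit groups.
        have : 3 ^ (2 * m + 1) + 1 = (9 ^ m - 1) * 3 + 4 := by
          have : 1 ≤ 9 ^ m := Nat.one_le_pow _ _ (by norm_num)
          rw [pow_succ, pow_mul, show 3 ^ 2 = 9 from rfl]
          omega
        rw [this]
        have h8 : 9 - 1 ∣ 9 ^ m - 1 := by simpa using Nat.sub_dvd_pow_sub_pow 9 1 m
        omega
      -- The index q + 1 is even, so s = u² in k and b = s² = u⁴.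
      · obtain ⟨u, hu, hsu⟩ := exists_pow_eq_algebraMap_of_card (k := k) (m := 2) (b := s) (by
          rw [hF, hk, hfac]
          refine mul_dvd_mul_right ?_ _
          have : Odd (3 ^ n) := Odd.pow (by decide)
          exact this.add_one.two_dvd) (left_ne_zero_of_mul hb)
        exact ⟨u, hu, by rw [map_mul, hsu]; ring⟩
    exact curveE_isCubicTwist h3 hn hu one_ne_zero (by rw [hbu, mul_one])
  · have : Finite l := Nat.finite_of_card_ne_zero (by rw [hl]; positivity)
    obtain ⟨u, hu, hbu⟩ := exists_pow_eq_algebraMap_of_card (k := l) (m := 4) (by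
      -- Both q² + 1 and q + 1 are even, so 4 divides the index.
      have hfac : 3 ^ (4 * n) - 1 = ((3 ^ n) ^ 2 + 1) * (3 ^ n + 1) * (3 ^ n - 1) := by
        rw [mul_assoc, ← Nat.sq_sub_sq, one_pow, ← one_pow 2, ← Nat.sq_sub_sq]
        ring_nf
      rw [hF, hl, hfac]
      refine mul_dvd_mul_right (mul_dvd_mul (a := 2) (c := 2) ?_ ?_) _
      · exact ((Odd.pow (Odd.pow (by decide))).add_one).two_dvd
      · exact ((Odd.pow (by decide)).add_one).two_dvd) hb
    exact curveE_isCubicTwist (three_eq_zero_of_card hl) hn hu one_ne_zero (by rw [hbu, mul_one])
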